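/- Let $V$ be a finite-dimensional vector space over the finite field $\mathbb{F}_q$ of order $q$, equipped with a non-degenerate alternating bilinear form, a non-degenerate Hermitian form (with respect to an automorphism of $\mathbb{F}_q$ of order $2$), or a non-singular quadratic form (no nonzero singular vector is orthogonal to all of $V$). The associated finite classical polar space $\mathcal{P}$ consists of the totally isotropic (respectively, totally singular) subspaces of $V$. Its rank $r$ is the largest vector space dimension of such a subspace, its generators are the subspaces of this dimension, and its points are the one-dimensional ones. With $n=\dim V$, the type $e$ of $\mathcal{P}$ is $1$ in the symplectic case, $n-2r+\tfrac12\in\{\tfrac12,\tfrac32\}$ in the Hermitian case, and $n-2r\in\{0,1,2\}$ in the orthogonal case. A partial $m$-ovoid of $\mathcal{P}$ is a set of points of $\mathcal{P}$ that meets every generator in at most $m$ points. There are absolute constants $c>0$ and $r_0$ such that for every prime power $q$, every $r\ge r_0$, every type $e$, every finite classical polar space $\mathcal{P}$ of rank $r$ and type $e$ over $\mathbb{F}_q$, and every integer $m\ge 0.51\,r$, there is a partial $m$-ovoid of $\mathcal{P}$ of size at least $q^{cr}$. That is, $\mathcal{P}$ has a partial $m$-ovoid of size $q^{\Omega(r)}$,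 with the implied constants independent of $q$, $e$ and $m$. -/

import Mathlib

open scoped LinearAlgebra.Projectivization

universe u v

/-- A form that defines a classical polar space on the vector space `V` over `K`: a non-degenerate
alternating bilinear form, a non-degenerate Hermitian form with respect to an involutory
automorphism `σ ≠ 1` of `K`, or a non-singular quadratic form (in every characteristic: no nonzero
singular vector is orthogonal to the whole space). -/
inductive PolarSpace (K : Type u) (V : Type v) [Field K] [AddCommGroup V] [Module K V] :
    Type (max u v)
  | symplectic (B : V →ₗ[K] V →ₗ[K] K) (alt : B.IsAlt) (nondeg : B.Nondegenerate)
  | hermitian (σ : K →+* K) (σ_ne : σ ≠ RingHom.id K) (σ_inv : ∀ a, σ (σ a) = a)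
      (B : V →ₛₗ[σ] V →ₗ[K] K) (symm : B.IsSymm) (nondeg : B.Nondegenerate)
  | orthogonal (Q : QuadraticForm K V) (nonsing : Q.radical = ⊥)

namespace PolarSpace

variable {K : Type u} {V : Type v} [Field K] [AddCommGroup V] [Module K V]

/-- The subspaces belonging to the polar space: the totally isotropic subspaces of a sesquilinear
form, the totally singular subspaces of a quadratic form. -/
def IsTotallySingular (P : PolarSpace K V) (W : Submodule K V) : Prop :=
  match P with
  | symplectic B _ _ => ∀ x ∈ W, ∀ y ∈ W, B x y = 0
  | hermitian _ _ _ B _ _ => ∀ x ∈ W, ∀ y ∈ W, B x y = 0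
  | orthogonal Q _ => ∀ x ∈ W, Q x = 0

/-- The rank (Witt index): the largest vector space dimension of a subspace belonging to `P`. -/
noncomputable def rank (P : PolarSpace K V) : ℕ :=
  sSup {d : ℕ | ∃ W : Submodule K V, P.IsTotallySingular W ∧ Module.finrank K W = d}

/-- The type `e`. With `n = dim V` and `r` the rank it is `1` for symplectic spaces; `1/2` or `3/2`
for Hermitian spaces with `n = 2r` or `n = 2r + 1`; and `0`, `1` or `2` for hyperbolic (`n = 2r`),
parabolic (`n = 2r + 1`) or elliptic (`n = 2r + 2`) quadrics. -/
noncomputable def typeParam (P : PolarSpace K V) : ℚ :=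
  match P with
  | symplectic _ _ _ => 1
  | hermitian σ σ_ne σ_inv B symm nondeg =>
      (Module.finrank K V : ℚ) - 2 * (hermitian σ σ_ne σ_inv B symm nondeg).rank + 1 / 2
  | orthogonal Q nonsing =>
      (Module.finrank K V : ℚ) - 2 * (orthogonal Q nonsing).rank

/-- The points of the polar space, as points of the ambient projective space. -/
def points (P : PolarSpace K V) : Set (ℙ K V) :=
  {p | P.IsTotallySingular p.submodule}

/-- The generators: the subspaces of maximal dimension belonging to the polar space. -/
def IsGenerator (P : PolarSpace K V) (W : Submodule K V) : Prop :=
  P.IsTotallySingular W ∧ Module.finrank K W = P.rank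

/-- A partial `m`-ovoid: a set of points that meets every generator in at most `m` points. -/
def IsPartialOvoid (P : PolarSpace K V) (m : ℕ) (O : Set (ℙ K V)) : Prop :=
  O ⊆ P.points ∧
    ∀ W : Submodule K V, P.IsGenerator W → {p ∈ O | p.submodule ≤ W}.encard ≤ m

end PolarSpace

namespace PolarSpace

/-! ### The form behind a polar space, uniformly in the three families. -/

section Form

variable {K : Type u} {V : Type v} [Field K] [AddCommGroup V] [Module K V]

/-! The partial ovoid is found by the probabilistic method, phrased as counting. Take `q ^ a`
singular vectors at random. A `k`-tuple is bad if it spans a totally singular subspace. Each new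
vector of such a tuple must be orthogonal to the previous ones, so with `n = dim V` there are at
most about `q ^ (n + (n - 1) + ... + (n - k + 1))` bad tuples, up to a factor `2 ^ k`
(`card_tuples_le`). At least `q ^ (n - 2)` vectors are singular (`card_le_card_singular_mul`), so
the bad fraction is at most `q ^ (3 * k - k * (k - 1) / 2)`. This is below `q ^ (-a * k)` once `k >
2 * a + 7`, and the union bound (`exists_forall_injective_not`) gives a sequence with no bad
`k`-subsequence.

No generator then contains `k` terms. A point is itself totally singular, so it repeats fewer than
`k` times, and passing from vectors to points costs only a factor linear in `a`. Taking `a`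
proportional to `r` gives the bound. The form enters only through `exists_form`, hence the
independence of the type. -/

theorem IsTotallySingular.mono {P : PolarSpace K V} {W W' : Submodule K V}
    (h : P.IsTotallySingular W') (hle : W ≤ W') : P.IsTotallySingular W := by
  cases P with
  | symplectic B _ _ => exact fun x hx y hy => h x (hle hx) y (hle hy)
  | hermitian σ _ _ B _ _ => exact fun x hx y hy => h x (hle hx) y (hle hy)
  | orthogonal Q _ => exact fun x hx => h x (hle hx)

theorem isTotallySingular_bot (P : PolarSpace K V) : P.IsTotallySingular ⊥ := by
  cases P with
  | symplectic B _ _ => intro x hx y _; simp [(Submodule.mem_bot K).1 hx]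
  | hermitian σ _ _ B _ _ => intro x hx y _; simp [(Submodule.mem_bot K).1 hx]
  | orthogonal Q _ => intro x hx; simp [(Submodule.mem_bot K).1 hx]

/-- An involutory automorphism `σ ≠ 1` of a field has a trace onto its fixed field. -/
theorem exists_add_conj_eq {σ : K →+* K} (σ_ne : σ ≠ RingHom.id K) (σ_inv : ∀ a, σ (σ a) = a)
    {a : K} (ha : σ a = a) : ∃ t, t + σ t = a := by
  -- If the trace vanished identically, its value at `1` would force characteristic 2, and then `σ x
  -- = -x = x` for all `x`.
  obtain ⟨u, hu⟩ : ∃ u, u + σ u ≠ 0 := by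
    by_contra! h
    have h1 : (1 : K) + 1 = 0 := by simpa using h 1
    refine σ_ne (RingHom.ext fun x => ?_)
    have hx := h x
    have hxx : x + x = 0 := by linear_combination x * h1
    rw [RingHom.id_apply]
    linear_combination hx - hxx
  refine ⟨a / (u + σ u) * u, ?_⟩
  rw [map_mul, map_div₀, map_add, σ_inv, ha, add_comm (σ u) u]
  field_simp

/-- The form underlying a polar space, viewed as an additive map into the dual space: it vanishes
on totally singular subspaces, no nonzero singular vector is in its radical, and every line joining
a singular point to a point not orthogonal to it contains a further singular point. -/
theorem exists_form (P : PolarSpace K V) : ∃ B : V →+ Module.Dual K V,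
    (∀ W, P.IsTotallySingular W → ∀ x ∈ W, ∀ y ∈ W, B x y = 0) ∧
    (∀ W, P.IsTotallySingular W → ∀ x ∈ W, B x = 0 → x = 0) ∧
    (∀ e v, P.IsTotallySingular (K ∙ e) → B e v = 1 →
      ∃ t : K, P.IsTotallySingular (K ∙ (v + t • e))) := by
  cases P with
  | symplectic B alt nondeg =>
    refine ⟨B.toAddMonoidHom, fun W h => h, fun W _ x _ hx => ?_, fun e v _ _ => ⟨0, ?_⟩⟩
    · exact nondeg.1 x fun y => congrArg (fun f : Module.Dual K V => f y) hx
    · intro x hx y hy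
      obtain ⟨a, rfl⟩ := Submodule.mem_span_singleton.1 hx
      obtain ⟨b, rfl⟩ := Submodule.mem_span_singleton.1 hy
      simp [alt.self_eq_zero]
  | hermitian σ σ_ne σ_inv B symm nondeg =>
    refine ⟨B.toAddMonoidHom, fun W h => h, fun W _ x _ hx => ?_, fun e v he hev => ?_⟩
    · exact nondeg.1 x fun y => congrArg (fun f : Module.Dual K V => f y) hx
    · have hev : B e v = 1 := hev
      have hee : B e e = 0 :=
        he e (Submodule.mem_span_singleton_self e) e (Submodule.mem_span_singleton_self e)
      have hve : B v e = 1 := by rw [← symm.eq, hev, map_one]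
      obtain ⟨t, ht⟩ := exists_add_conj_eq σ_ne σ_inv (a := -B v v) (by rw [map_neg, symm.eq])
      refine ⟨t, fun x hx y hy => ?_⟩
      obtain ⟨a, rfl⟩ := Submodule.mem_span_singleton.1 hx
      obtain ⟨b, rfl⟩ := Submodule.mem_span_singleton.1 hy
      have h0 : B (v + t • e) (v + t • e) = 0 := by
        simp only [map_add, LinearMap.add_apply, map_smul, LinearMap.map_smulₛₗ,
          LinearMap.smul_apply, smul_eq_mul, hev, hve, hee]
        linear_combination ht
      simp only [map_smul, LinearMap.map_smulₛₗ, LinearMap.smul_apply, h0, smul_zero]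
  | orthogonal Q nonsing =>
    refine ⟨Q.polarBilin.toAddMonoidHom, fun W h x hx y hy => ?_, fun W h x hx hx0 => ?_,
      fun e v he hev => ⟨-Q v, fun x hx => ?_⟩⟩
    · change QuadraticMap.polar Q x y = 0
      rw [QuadraticMap.polar, h _ (W.add_mem hx hy), h x hx, h y hy]
      simp
    -- In characteristic 2 the polar form itself may be degenerate; only its singular radical
    -- vectors vanish.
    · have : x ∈ Q.radical := ⟨h x hx, hx0⟩
      rwa [nonsing, Submodule.mem_bot] at this
    · have hev : QuadraticMap.polar Q e v = 1 := hev
      have hee : Q e = 0 := he e (Submodule.mem_span_singleton_self e)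
      obtain ⟨a, rfl⟩ := Submodule.mem_span_singleton.1 hx
      rw [QuadraticMap.map_smul, QuadraticMap.map_add Q, QuadraticMap.map_smul, hee,
        QuadraticMap.polar_smul_right, QuadraticMap.polar_comm, hev]
      simp

theorem exists_finrank_eq_rank [FiniteDimensional K V] (P : PolarSpace K V) :
    ∃ W : Submodule K V, P.IsTotallySingular W ∧ Module.finrank K W = P.rank := by
  refine Nat.sSup_mem (s := {d : ℕ | ∃ W : Submodule K V, P.IsTotallySingular W ∧
    Module.finrank K W = d}) ⟨0, ⊥, P.isTotallySingular_bot, finrank_bot K V⟩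
    ⟨Module.finrank K V, ?_⟩
  rintro _ ⟨W, -, rfl⟩
  exact W.finrank_le

end Form

/-! ### Counting singular vectors and totally singular tuples. -/

section Counting

variable {K : Type u} {V : Type v} [Field K] [Finite K] [AddCommGroup V] [Module K V]
  [FiniteDimensional K V]

/-- An additive map `B : V → V*` that is injective on `D` pairs `D` with at most
`q ^ (dim V - dim D)` vectors trivially. -/
theorem card_orthogonal_le (B : V →+ Module.Dual K V) (D : Submodule K V)
    (hB : ∀ x ∈ D, B x = 0 → x = 0) :
    Nat.card {v : V // ∀ x ∈ D, B x v = 0} ≤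
      Nat.card K ^ (Module.finrank K V - Module.finrank K D) := by
  let E : Submodule K V := ⨅ x : D, LinearMap.ker (B x)
  have hE : ∀ v, v ∈ E ↔ ∀ x ∈ D, B x v = 0 := fun v => by simp [E, Submodule.mem_iInf]
  have hEle : ∀ x : D, E ≤ LinearMap.ker (B x) := fun x => iInf_le _ x
  have : Finite V := Module.finite_of_finite K
  -- `E` is the orthogonal of `D`, so `D` embeds in the dual of `V ⧸ E`. The embedding is merely
  -- additive, hence cardinalities are compared instead of dimensions.
  let φ : D → Module.Dual K (V ⧸ E) := fun x => E.liftQ (B x) (hEle x)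
  have hφ : Function.Injective φ := by
    intro x y hxy
    have h : B (x - y : V) = 0 := by
      ext v
      have := congrArg (fun f : Module.Dual K (V ⧸ E) => f (E.mkQ v)) hxy
      simpa [φ, sub_eq_zero] using this
    exact Subtype.ext (sub_eq_zero.1 (hB _ (D.sub_mem x.2 y.2) h))
  have : Finite (Module.Dual K (V ⧸ E)) := Module.finite_of_finite K
  have h1 := Nat.card_le_card_of_injective φ hφ
  rw [Module.natCard_eq_pow_finrank (K := K) (V := D),
    Module.natCard_eq_pow_finrank (K := K) (V := Module.Dual K (V ⧸ E)), Subspace.dual_finrank_eq] at h1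
  have h2 := (Nat.pow_le_pow_iff_right (Finite.one_lt_card (α := K))).1 h1
  have h3 := E.finrank_quotient_add_finrank
  have h4 : Nat.card {v : V // ∀ x ∈ D, B x v = 0} = Nat.card E :=
    Nat.card_congr (Equiv.subtypeEquivRight fun v => (hE v).symm)
  rw [h4, Module.natCard_eq_pow_finrank (K := K)]
  exact Nat.pow_le_pow_right Nat.card_pos (by omega)

/-- At least a fraction `1 / q ^ 2` of all vectors are nonzero singular vectors, provided that there
is one. -/
theorem card_le_card_singular_mul (P : PolarSpace K V) {e : V} (he0 : e ≠ 0)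
    (he : P.IsTotallySingular (K ∙ e)) :
    Nat.card K ^ Module.finrank K V ≤
      Nat.card {v : V // v ≠ 0 ∧ P.IsTotallySingular (K ∙ v)} * Nat.card K ^ 2 := by
  obtain ⟨B, hB0, hB, hline⟩ := P.exists_form
  have hBe : B e ≠ 0 := fun h => he0 (hB _ he e (Submodule.mem_span_singleton_self e) h)
  obtain ⟨g, hg⟩ : ∃ g, B e g = 1 := LinearMap.surjective hBe 1
  have : Finite V := Module.finite_of_finite K
  let φ : {v : V // v ≠ 0 ∧ P.IsTotallySingular (K ∙ v)} × K × K → V :=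
    fun s => s.1 - s.2.1 • e + s.2.2 • g
  have hee : B e e = 0 := hB0 _ he e (Submodule.mem_span_singleton_self e) e
    (Submodule.mem_span_singleton_self e)
  have hφ : Function.Surjective φ := by
    intro v
    -- A shift along `g` makes the pairing with `e` equal to 1, and a shift along `e` then reaches a
    -- singular vector. Two scalars thus recover `v`, which explains the factor `q ^ 2`.
    have hv : B e (v - (B e v - 1) • g) = 1 := by simp [hg]
    obtain ⟨t, ht⟩ := hline e _ he hv
    refine ⟨⟨⟨_, ?_, ht⟩, t, B e v - 1⟩, ?_⟩
    · intro h0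
      have h1 := congrArg (B e) h0
      rw [map_add, hv, map_smul, hee] at h1
      simp at h1
    · simp [φ]
  have := Nat.card_le_card_of_surjective φ hφ
  rwa [Nat.card_prod, Nat.card_prod, ← sq, Module.natCard_eq_pow_finrank (K := K)] at this

/-- The number of `l`-tuples of vectors that span a totally singular subspace together with `D`. -/
theorem card_tuples_le (P : PolarSpace K V) (l : ℕ) : ∀ D : Submodule K V,
    2 * (Module.finrank K D + l) ≤ Module.finrank K V →
    Nat.card {v : Fin l → V // P.IsTotallySingular (D ⊔ Submodule.span K (Set.range v))} ≤
      2 ^ l * Nat.card K ^ ∑ i ∈ Finset.range l,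
        (Module.finrank K V - Module.finrank K D - i) := by
  classical
  have : Finite V := Module.finite_of_finite K
  have : Fintype V := Fintype.ofFinite V
  obtain ⟨B, hB0, hB, -⟩ := P.exists_form
  induction l with
  | zero =>
    intro D _
    have : Nat.card {v : Fin 0 → V // P.IsTotallySingular (D ⊔ Submodule.span K (Set.range v))}
        ≤ Nat.card (Fin 0 → V) := Finite.card_subtype_le _
    simpa using this
  | succ l ih =>
    intro D hD
    by_cases hDs : P.IsTotallySingular D
    swap
    · have : IsEmpty {v : Fin (l + 1) → V //
          P.IsTotallySingular (D ⊔ Submodule.span K (Set.range v))} :=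
        ⟨fun v => hDs (v.2.mono le_sup_left)⟩
      simp
    set n := Module.finrank K V with hn
    set d := Module.finrank K D with hd
    set q := Nat.card K with hq
    have hq1 : 1 ≤ q := Nat.card_pos
    let T : Finset (Fin (l + 1) → V) :=
      {v | P.IsTotallySingular (D ⊔ Submodule.span K (Set.range v))}
    have hT : Nat.card {v : Fin (l + 1) → V //
        P.IsTotallySingular (D ⊔ Submodule.span K (Set.range v))} = T.card := by
      rw [Nat.card_eq_fintype_card, Fintype.card_subtype]
    have hfib : ∀ x : V, (T.filter fun v => v 0 = x).card ≤
        Nat.card {v : Fin l → V //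
          P.IsTotallySingular ((D ⊔ K ∙ x) ⊔ Submodule.span K (Set.range v))} := by
      intro x
      rw [Nat.card_eq_fintype_card, Fintype.card_subtype]
      refine Finset.card_le_card_of_injOn Fin.tail ?_ ?_
      · intro v hv
        simp only [Finset.coe_filter, Finset.mem_filter, Finset.mem_univ, true_and, T,
          Set.mem_ofPred_eq] at hv ⊢
        refine hv.1.mono ?_
        rw [sup_assoc]
        refine sup_le_sup_left (sup_le ?_ ?_) D
        · rw [Submodule.span_singleton_le_iff_mem, ← hv.2]
          exact Submodule.subset_span ⟨0, rfl⟩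
        · refine Submodule.span_mono ?_
          rintro _ ⟨i, rfl⟩
          exact ⟨i.succ, rfl⟩
      · intro v hv w hw hvw
        simp only [Finset.coe_filter, Set.mem_ofPred_eq] at hv hw
        rw [← Fin.cons_self_tail v, ← Fin.cons_self_tail w, hvw, hv.2, hw.2]
    -- A first vector inside `D` leaves `D` unchanged and has `q ^ d` choices. The dimension
    -- hypothesis gives `d ≤ n - d - l`, so these fit in the last factor of the product.
    have hin : (T.filter fun v => v 0 ∈ D).card ≤
        2 ^ l * q ^ ∑ i ∈ Finset.range (l + 1), (n - d - i) := by
      have himg : ((T.filter fun v => v 0 ∈ D).image fun v => v 0).card ≤ q ^ d := by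
        rw [hq, hd, ← Module.natCard_eq_pow_finrank (K := K) (V := D), Nat.card_eq_fintype_card,
          Fintype.card_subtype]
        refine Finset.card_le_card fun x hx => ?_
        obtain ⟨v, hv, rfl⟩ := Finset.mem_image.1 hx
        simpa using (Finset.mem_filter.1 hv).2
      refine (Finset.card_le_mul_card_image (f := fun v : Fin (l + 1) → V => v 0) _
        (2 ^ l * q ^ ∑ i ∈ Finset.range l, (n - d - i)) ?_).trans ?_
      · intro x hx
        obtain ⟨v, hv, rfl⟩ := Finset.mem_image.1 hx
        have hxD := (Finset.mem_filter.1 hv).2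
        refine le_trans (Finset.card_le_card ?_) ((hfib (v 0)).trans ?_)
        · exact Finset.filter_subset_filter _ (Finset.filter_subset _ _)
        · rw [sup_eq_left.2 ((Submodule.span_singleton_le_iff_mem _ _).2 hxD)]
          exact ih D (by omega)
      · refine (Nat.mul_le_mul_left _ himg).trans ?_
        rw [mul_assoc, ← pow_add, Finset.sum_range_succ]
        exact Nat.mul_le_mul_left _ (Nat.pow_le_pow_right hq1 (by omega))
    -- A first vector outside `D` lies in the orthogonal of `D` and raises the dimension by one,
    -- which shifts the exponents of the induction hypothesis.
    have hout : (T.filter fun v => v 0 ∉ D).card ≤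
        2 ^ l * q ^ ∑ i ∈ Finset.range (l + 1), (n - d - i) := by
      have himg : ((T.filter fun v => v 0 ∉ D).image fun v => v 0).card ≤ q ^ (n - d) := by
        refine le_trans ?_ (card_orthogonal_le B D (hB D hDs))
        rw [Nat.card_eq_fintype_card, Fintype.card_subtype]
        refine Finset.card_le_card fun x hx => ?_
        obtain ⟨v, hv, rfl⟩ := Finset.mem_image.1 hx
        have hv' := (Finset.mem_filter.1 (Finset.mem_filter.1 hv).1).2
        simp only [Finset.mem_filter, Finset.mem_univ, true_and]
        exact fun y hy => hB0 _ hv' y (Submodule.mem_sup_left hy) _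
          (Submodule.mem_sup_right (Submodule.subset_span ⟨0, rfl⟩))
      refine (Finset.card_le_mul_card_image (f := fun v : Fin (l + 1) → V => v 0) _
        (2 ^ l * q ^ ∑ i ∈ Finset.range l, (n - d - (i + 1))) ?_).trans ?_
      · intro x hx
        obtain ⟨v, hv, rfl⟩ := Finset.mem_image.1 hx
        have hxD := (Finset.mem_filter.1 hv).2
        refine le_trans (Finset.card_le_card ?_) ((hfib (v 0)).trans ?_)
        · exact Finset.filter_subset_filter _ (Finset.filter_subset _ _)
        · have hfr : Module.finrank K ↥(D ⊔ K ∙ v 0) = d + 1 :=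
            Submodule.finrank_sup_span_singleton hxD
          refine (ih _ (by omega)).trans_eq ?_
          rw [hfr]
          simp only [Nat.sub_sub, add_assoc, add_comm 1]
      · refine (Nat.mul_le_mul_left _ himg).trans ?_
        rw [mul_assoc, ← pow_add, Finset.sum_range_succ', Nat.sub_zero]
    rw [hT, ← Finset.card_filter_add_card_filter_not (s := T) (fun v => v 0 ∈ D), pow_succ]
    linarith

end Counting

end PolarSpace

/-! ### The union bound. -/

/-- If fewer than a fraction `N ^ (-k)` of all `k`-tuples in `S` are bad, then there is a sequence
of length `N` none of whose `k`-term subsequences is bad. -/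
theorem exists_forall_injective_not {S : Type*} [Finite S] [Nonempty S] (N k : ℕ) (bad : (Fin k → S) → Prop)
    (h : N ^ k * Nat.card {v // bad v} < Nat.card S ^ k) :
    ∃ f : Fin N → S, ∀ j : Fin k → Fin N, Function.Injective j → ¬ bad (f ∘ j) := by
  classical
  have : Fintype S := Fintype.ofFinite S
  by_contra! hcon
  let J := {j : Fin k → Fin N // Function.Injective j}
  let A : J → Finset (Fin N → S) := fun j => {f | bad (f ∘ j.1)}
  have hcov : (Finset.univ : Finset (Fin N → S)) ⊆ Finset.univ.biUnion A := by
    intro f _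
    obtain ⟨j, hj, hbad⟩ := hcon f
    exact Finset.mem_biUnion.2 ⟨⟨j, hj⟩, Finset.mem_univ _, by simpa [A] using hbad⟩
  have hA : ∀ j ∈ (Finset.univ : Finset J),
      (A j).card ≤ Nat.card {v // bad v} * Nat.card S ^ (N - k) := by
    intro j _
    have hcompl : Nat.card {i : Fin N // i ∉ Set.range j.1} = N - k := by
      rw [Nat.card_eq_fintype_card, Fintype.card_subtype_compl, Fintype.card_fin,
        ← Nat.card_eq_fintype_card]
      congr 1
      exact (Nat.card_range_of_injective j.2).trans (Nat.card_fin k)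
    have hcard : Nat.card ({v // bad v} × ({i : Fin N // i ∉ Set.range j.1} → S)) =
        Nat.card {v // bad v} * Nat.card S ^ (N - k) := by
      rw [Nat.card_prod, Nat.card_fun, hcompl]
    -- A sequence is determined by its bad subsequence along `j` and its values off the range of
    -- `j`.
    rw [← hcard, ← Fintype.card_coe, ← Nat.card_eq_fintype_card]
    refine Nat.card_le_card_of_injective
      (fun f => (⟨f.1 ∘ j.1, (Finset.mem_filter.1 f.2).2⟩, fun i => f.1 i.1)) ?_
    rintro ⟨f, hf⟩ ⟨g, hg⟩ hfg
    rw [Prod.mk.injEq, Subtype.mk.injEq] at hfg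
    refine Subtype.ext (funext fun i => ?_)
    by_cases hi : i ∈ Set.range j.1
    · obtain ⟨i, rfl⟩ := hi
      exact congrFun hfg.1 i
    · exact congrFun hfg.2 ⟨i, hi⟩
  have hJ : (Finset.univ : Finset J).card ≤ N ^ k := by
    refine (Fintype.card_subtype_le _).trans ?_
    simp
  -- The negated conclusion, at any sequence, supplies an injection `Fin k → Fin N`.
  have hkN : k ≤ N := by
    obtain ⟨j, hj, -⟩ := hcon fun _ => Classical.arbitrary S
    simpa using Fintype.card_le_of_injective j hj
  have hcount := (Finset.card_le_card hcov).trans (Finset.card_biUnion_le_card_mul _ _ _ hA)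
  have hlt : N ^ k * Nat.card {v // bad v} * Nat.card S ^ (N - k) < Nat.card S ^ N := by
    rw [← pow_mul_pow_sub (Nat.card S) hkN]
    exact Nat.mul_lt_mul_of_pos_right h (Nat.pow_pos Nat.card_pos)
  rw [Finset.card_univ, Fintype.card_fun, Fintype.card_fin, ← Nat.card_eq_fintype_card] at hcount
  refine absurd (hcount.trans ?_) (not_le.2 hlt)
  rw [mul_assoc]
  exact Nat.mul_le_mul_right _ hJ

/-! ### Construction of the partial ovoid. -/

namespace PolarSpace

variable {K : Type u} {V : Type v} [Field K] [Finite K] [AddCommGroup V] [Module K V]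
  [FiniteDimensional K V]

/-- A long sequence of nonzero singular vectors of which no `k` lie in a common totally singular
subspace. -/
theorem exists_singular_sequence (P : PolarSpace K V) {e : V} (he0 : e ≠ 0)
    (he : P.IsTotallySingular (K ∙ e)) (a : ℕ) (hn : 2 * (2 * a + 8) ≤ Module.finrank K V) :
    ∃ f : Fin (Nat.card K ^ a) → {v : V // v ≠ 0 ∧ P.IsTotallySingular (K ∙ v)},
      ∀ W, P.IsTotallySingular W → ∀ j : Fin (2 * a + 8) → Fin (Nat.card K ^ a),
        Function.Injective j → ∃ i, (f (j i) : V) ∉ W := by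
  have : Finite V := Module.finite_of_finite K
  have : Nonempty {v : V // v ≠ 0 ∧ P.IsTotallySingular (K ∙ v)} := ⟨⟨e, he0, he⟩⟩
  have hS := P.card_le_card_singular_mul he0 he
  have hbot := P.card_tuples_le (2 * a + 8) ⊥ (by simpa using hn)
  have hq : 2 ≤ Nat.card K := Finite.one_lt_card
  set k := 2 * a + 8 with hk
  set q := Nat.card K
  set n := Module.finrank K V
  set M := Nat.card {v : V // v ≠ 0 ∧ P.IsTotallySingular (K ∙ v)}
  have hM : 0 < M := Nat.card_pos
  let bad : (Fin k → {v : V // v ≠ 0 ∧ P.IsTotallySingular (K ∙ v)}) → Prop :=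
    fun v => P.IsTotallySingular (Submodule.span K (Set.range fun i => (v i : V)))
  have hbad : Nat.card {v // bad v} ≤ 2 ^ k * q ^ ∑ i ∈ Finset.range k, (n - i) := by
    simp only [finrank_bot, bot_sup_eq, Nat.sub_zero] at hbot
    refine le_trans (Nat.card_le_card_of_injective
      (fun v => ⟨fun i => (v.1 i : V), v.2⟩) ?_) hbot
    intro v w hvw
    rw [Subtype.mk.injEq] at hvw
    exact Subtype.ext (funext fun i => Subtype.ext (congrFun hvw i))
  have hsum : (∑ i ∈ Finset.range k, (n - i)) + (a + 4) * (2 * a + 7) = n * k := by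
    have h1 : ∑ i ∈ Finset.range k, i = (a + 4) * (2 * a + 7) := by
      have := Finset.sum_range_id_mul_two k
      rw [hk, show 2 * a + 8 - 1 = 2 * a + 7 by omega] at this
      rw [hk]
      linarith
    rw [← h1, ← Finset.sum_add_distrib, Finset.sum_congr rfl (g := fun _ => n), Finset.sum_const,
      Finset.card_range, smul_eq_mul, mul_comm]
    intro i hi
    have := Finset.mem_range.1 hi
    omega
  have hlt : (q ^ a) ^ k * Nat.card {v // bad v} < M ^ k := by
    -- The factor is `q ^ (k * (k - 1) / 2)`, the saving in `hsum`. What remains is `(a + 3) * k < k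
    -- * (k - 1) / 2`, for which `k = 2 * a + 8` is the least choice.
    refine lt_of_mul_lt_mul_right' (a := q ^ ((a + 4) * (2 * a + 7))) ?_
    calc (q ^ a) ^ k * Nat.card {v // bad v} * q ^ ((a + 4) * (2 * a + 7))
        ≤ (q ^ a) ^ k * (2 ^ k * q ^ ∑ i ∈ Finset.range k, (n - i)) *
            q ^ ((a + 4) * (2 * a + 7)) := by gcongr
      _ = (q ^ a) ^ k * 2 ^ k * (q ^ n) ^ k := by
          rw [← pow_mul q n, ← hsum, pow_add]; ring
      _ ≤ (q ^ a) ^ k * q ^ k * (M * q ^ 2) ^ k := by gcongr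
      _ = M ^ k * q ^ ((a + 3) * k) := by
          rw [mul_comm (a + 3) k, pow_mul' q k, pow_add]; ring
      _ < M ^ k * q ^ ((a + 4) * (2 * a + 7)) := by
          refine Nat.mul_lt_mul_of_pos_left (Nat.pow_lt_pow_right hq ?_) (Nat.pow_pos hM)
          rw [hk]; nlinarith
  obtain ⟨f, hf⟩ := exists_forall_injective_not _ _ bad hlt
  refine ⟨f, fun W hW j hj => ?_⟩
  by_contra! hmem
  refine hf j hj (hW.mono (Submodule.span_le.2 ?_))
  rintro _ ⟨i, rfl⟩
  exact hmem i

/-- The sequence is taken of length `q ^ (2 * b)`, twice the target exponent, so that a factor `q ^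
b` is available to absorb repeated points. -/
theorem exists_isPartialOvoid (P : PolarSpace K V) {e : V} (he0 : e ≠ 0)
    (he : P.IsTotallySingular (K ∙ e)) (b m : ℕ) (hb : 5 ≤ b) (hm : 4 * b + 8 ≤ m)
    (hn : 2 * (4 * b + 8) ≤ Module.finrank K V) :
    ∃ O : Set (ℙ K V), P.IsPartialOvoid m O ∧ Nat.card K ^ b ≤ O.ncard := by
  classical
  obtain ⟨f, hf⟩ := P.exists_singular_sequence he0 he (2 * b) (by omega)
  have hfib : ∀ W, P.IsTotallySingular W → ∀ s : Finset (Fin (Nat.card K ^ (2 * b))),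
      (∀ i ∈ s, (f i : V) ∈ W) → s.card ≤ 4 * b + 8 := by
    intro W hW s hs
    by_contra! hcard
    obtain ⟨t, hts, ht⟩ := Finset.exists_subset_card_eq
      (show 2 * (2 * b) + 8 ≤ s.card by omega)
    obtain ⟨i, hi⟩ := hf W hW (fun i => (t.equivFin.symm (Fin.cast ht.symm i)).1)
      (Subtype.val_injective.comp (t.equivFin.symm.injective.comp (Fin.cast_injective _)))
    exact hi (hs _ (hts (Subtype.prop _)))
  let g : Fin (Nat.card K ^ (2 * b)) → ℙ K V := fun i => Projectivization.mk K (f i) (f i).2.1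
  have hg : ∀ i, (g i).submodule = K ∙ (f i : V) := fun i => Projectivization.submodule_mk _ _
  refine ⟨Set.range g, ⟨?_, fun W hW => ?_⟩, ?_⟩
  · rintro _ ⟨i, rfl⟩
    change P.IsTotallySingular (g i).submodule
    rw [hg]
    exact (f i).2.2
  · let s : Finset (Fin (Nat.card K ^ (2 * b))) := {i | (f i : V) ∈ W}
    have hsub : {p ∈ Set.range g | p.submodule ≤ W} ⊆ (s.image g : Finset (ℙ K V)) := by
      rintro _ ⟨⟨i, rfl⟩, hi⟩
      rw [hg, Submodule.span_singleton_le_iff_mem] at hi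
      simpa using ⟨i, by simpa [s] using hi, rfl⟩
    refine (Set.encard_le_encard hsub).trans ?_
    rw [Set.encard_coe_eq_coe_finsetCard]
    exact_mod_cast Finset.card_image_le.trans
      ((hfib W hW.1 s fun i hi => (Finset.mem_filter.1 hi).2).trans hm)
  · have hcount := Finset.card_le_mul_card_image (f := g) Finset.univ (4 * b + 8) (by
      intro p hp
      obtain ⟨i, -, rfl⟩ := Finset.mem_image.1 hp
      refine hfib (K ∙ (f i : V)) (f i).2.2 _ fun i' hi' => ?_
      rw [← hg i, ← (Finset.mem_filter.1 hi').2, hg i']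
      exact Submodule.mem_span_singleton_self _)
    rw [Finset.card_univ, Fintype.card_fin] at hcount
    have hrange : (Set.range g).ncard = (Finset.univ.image g).card := by
      rw [← Set.ncard_coe_finset, Finset.coe_image, Finset.coe_univ, Set.image_univ]
    have hq : 2 ≤ Nat.card K := Finite.one_lt_card
    -- The condition `5 ≤ b` is sharp here: `28 ≤ 32`, while `24 > 16` at `b = 4`.
    have hb2 : 4 * b + 8 ≤ 2 ^ b := by
      clear * - hb
      induction b, hb using Nat.le_induction with
      | base => norm_num
      | succ b hb ih => rw [pow_succ]; omega
    have hbq : 4 * b + 8 ≤ Nat.card K ^ b := hb2.trans (Nat.pow_le_pow_left hq b)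
    rw [hrange]
    refine Nat.le_of_mul_le_mul_left (c := Nat.card K ^ b) ?_ (Nat.pow_pos Nat.card_pos)
    rw [← pow_add, ← two_mul]
    exact hcount.trans (Nat.mul_le_mul_right _ hbq)

end PolarSpace

theorem proposition5p1 :
    ∃ c : ℝ, 0 < c ∧ ∃ r₀ : ℕ,
      ∀ (K : Type u) (V : Type v) [Field K] [Finite K] [AddCommGroup V] [Module K V]
        [FiniteDimensional K V] (P : PolarSpace K V) (q r m : ℕ) (e : ℚ),
        Nat.card K = q → P.rank = r → P.typeParam = e → r₀ ≤ r → (0.51 : ℝ) * r ≤ m →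
        ∃ O : Set (ℙ K V), P.IsPartialOvoid m O ∧ (q : ℝ) ^ (c * r) ≤ (O.ncard : ℝ) := by
  -- With `b = r / 16` rounded down, `r ≥ 80` gives `b ≥ 5`, and `b ≥ r / 32` gives the constant.
  -- Also `4 * b + 8 ≤ r / 4 + 8 ≤ r / 2`, which covers the conditions on `m` and on `dim V`.
  refine ⟨1 / 32, by norm_num, 80, ?_⟩
  intro K V _ _ _ _ _ P q r m e hq hr _ hr0 hm
  obtain ⟨W, hW, hWr⟩ := P.exists_finrank_eq_rank
  have hrn : r ≤ Module.finrank K V := by rw [← hr, ← hWr]; exact W.finrank_le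
  have hWbot : W ≠ ⊥ := by
    rintro rfl
    rw [finrank_bot] at hWr
    omega
  obtain ⟨x, hx, hx0⟩ := W.exists_mem_ne_zero_of_ne_bot hWbot
  have hxs : P.IsTotallySingular (K ∙ x) :=
    hW.mono ((Submodule.span_singleton_le_iff_mem _ _).2 hx)
  have hrm : r ≤ 2 * m := by
    have : (r : ℝ) ≤ 2 * m := by linarith [(Nat.cast_nonneg r : (0 : ℝ) ≤ r)]
    exact_mod_cast this
  obtain ⟨O, hO, hcard⟩ := P.exists_isPartialOvoid hx0 hxs (r / 16) m (by omega) (by omega)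
    (by omega)
  refine ⟨O, hO, ?_⟩
  have hexp : (1 / 32 : ℝ) * r ≤ (r / 16 : ℕ) := by
    have : r ≤ 32 * (r / 16) := by omega
    have : (r : ℝ) ≤ 32 * (r / 16 : ℕ) := by exact_mod_cast this
    linarith
  have hq1 : (1 : ℝ) ≤ q := by
    rw [← hq]
    exact_mod_cast (Nat.card_pos : 0 < Nat.card K)
  calc (q : ℝ) ^ ((1 / 32 : ℝ) * r) ≤ (q : ℝ) ^ ((r / 16 : ℕ) : ℝ) :=
        Real.rpow_le_rpow_of_exponent_le hq1 hexp
    _ = ((q ^ (r / 16) : ℕ) : ℝ) := by rw [Real.rpow_natCast, Nat.cast_pow]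
    _ ≤ O.ncard := by rw [← hq]; exact_mod_cast hcard
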